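/- Let $\mathcal G=(\mathcal V,\mathcal E,w)$ be a finite undirected weighted graph with symmetric weights $w(i,j)\ge 0$ (positive exactly on the edges) and Laplacian $L=D-W$, where $W=[w(i,j)]_{i,j}$ and $D=\mathrm{diag}\big(\sum_j w(i,j)\big)$. Let $\ell\subset\mathcal V$ be the set of labelled vertices and $u=\mathcal V\setminus\ell$, and assume that every connected component of $\mathcal G$ contains a vertex of $\ell$. Let $y_c\in\mathbb R^{\mathcal V}$. For $\alpha>0$ put $q_i=\alpha$ if $i\in\ell$ and $q_i=0$ if $i\in u$, and let $\Phi_Q$ be the random rooted spanning forest of $\mathcal G$ with law $$\mathbb P(\Phi_Q=\phi)=\frac1Z\prod_{i\in\rho(\phi)}q_i\prod_{(i,j)\in\phi}w(i,j),$$ where $\phi$ ranges over all rooted spanning forests of $\mathcal G$ (all edges directed towards the roots), $\rho(\phi)$ is the set of roots of $\phi$, and $Z$ is the normalizing constant. Let $r_\phi(i)$ be the root of the tree of $\phi$ containing $i$, and let $\tilde x(i)=y_c(r_{\Phi_Q}(i))$ for $i\in\mathcal V$. Then the law of $\Phi_Q$ is well defined for every $\alpha>0$, the block $L_{u|u}$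 is invertible, the Dirichlet problem $$(Lf)(i)=0\ \text{ for } i\in u,\qquad f(i)=y_c(i)\ \text{ for } i\in\ell,$$ has exactly one solution $f_c\in\mathbb R^{\mathcal V}$, given by $f_c=y_c$ on $\ell$ and $f_c=-(L_{u|u})^{-1}L_{u|\ell}\,(y_c)_\ell$ on $u$, and $$\lim_{\alpha\to\infty}\mathbb E[\tilde x]=f_c .$$ -/

import Mathlib

open Filter Topology MeasureTheory

/-- An undirected weighted graph on the vertex set `V`: a symmetric nonnegative weight function,
the pair `(i, j)` being an edge iff `w i j > 0`.  (Self-loops play no role: they cancel in the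
Laplacian and cannot occur in a forest.) -/
structure WeightedGraph (V : Type*) where
  /-- the weight function -/
  w : V → V → ℝ
  symm : ∀ i j, w i j = w j i
  nonneg : ∀ i j, 0 ≤ w i j

namespace WeightedGraph

section Basic

variable {V : Type*} (G : WeightedGraph V)

/-- The underlying simple graph, used to speak about connectivity. -/
def toSimpleGraph : SimpleGraph V where
  Adj i j := i ≠ j ∧ 0 < G.w i j
  symm := ⟨fun i j h => ⟨h.1.symm, by rw [G.symm j i]; exact h.2⟩⟩
  loopless := ⟨fun _ h => h.1 rfl⟩

/-- The graph Laplacian `L = D - W`. -/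
def laplacian [Fintype V] [DecidableEq V] : Matrix V V ℝ :=
  Matrix.diagonal (fun i => ∑ j, G.w i j) - Matrix.of G.w

/-- A rooted spanning forest of `G`: every edge of the forest is directed towards the root of its
tree, so the forest is given by the map sending each vertex to the endpoint of its outgoing edge
(`none` at the roots).  The edges are edges of `G`, and following the edges from any vertex one
arrives at a root (so there are no cycles). -/
@[ext]
structure RootedForest where
  /-- the endpoint of the edge leaving a vertex; `none` if the vertex is a root -/
  next : V → Option V
  edge_pos : ∀ i j, next i = some j → 0 < G.w i j
  exists_root : ∀ i, ∃ r, next r = none ∧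
    Relation.ReflTransGen (fun a b => next a = some b) i r

namespace RootedForest

variable {G}

/-- The root function: the root of the tree containing `i`. -/
noncomputable def root (φ : G.RootedForest) (i : V) : V :=
  (φ.exists_root i).choose

theorem next_root (φ : G.RootedForest) (i : V) : φ.next (φ.root i) = none :=
  (φ.exists_root i).choose_spec.1

theorem path_root (φ : G.RootedForest) (i : V) :
    Relation.ReflTransGen (fun a b => φ.next a = some b) i (φ.root i) :=
  (φ.exists_root i).choose_spec.2

/-- The root reached from a vertex is unique. -/
theorem root_eq (φ : G.RootedForest) {i r : V} (hr : φ.next r = none)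
    (h : Relation.ReflTransGen (fun a b => φ.next a = some b) i r) : φ.root i = r := by
  have key : ∀ s, φ.next s = none →
      Relation.ReflTransGen (fun a b => φ.next a = some b) i s → s = r := by
    induction h using Relation.ReflTransGen.head_induction_on with
    | refl =>
      intro s _ hp
      rcases Relation.ReflTransGen.cases_head hp with h | ⟨c, hc, _⟩
      · exact h.symm
      · rw [hr] at hc; exact absurd hc (by simp)
    | head hac _ ih =>
      intro s hs hp
      rcases Relation.ReflTransGen.cases_head hp with h | ⟨d, hd, hp'⟩
      · subst h; rw [hs] at hac; exact absurd hac (by simp)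
      · have hcd := Option.some.inj (hac.symm.trans hd)
        subst hcd
        exact ih s hs hp'
  exact key _ (φ.next_root i) (φ.path_root i)

/-- There are finitely many rooted spanning forests. -/
noncomputable instance [Fintype V] : Fintype G.RootedForest := by
  classical
  exact Fintype.ofInjective (fun φ : G.RootedForest => φ.next)
    (fun _ _ h => RootedForest.ext h)

/-- All subsets of the finite set of rooted spanning forests are events. -/
instance : MeasurableSpace G.RootedForest := ⊤

/-- The set `ρ(φ)` of roots. -/
def roots [Fintype V] (φ : G.RootedForest) : Finset V :=
  Finset.univ.filter fun i => φ.next i = none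

/-- The set of directed edges of the forest. -/
def edges [Fintype V] [DecidableEq V] (φ : G.RootedForest) : Finset (V × V) :=
  Finset.univ.filter fun e => φ.next e.1 = some e.2

/-- The unnormalized probability `∏_{i ∈ ρ(φ)} q_i · ∏_{(i,j) ∈ φ} w(i,j)`. -/
noncomputable def weight [Fintype V] [DecidableEq V] (q : V → ℝ) (φ : G.RootedForest) : ℝ :=
  (∏ i ∈ φ.roots, q i) * ∏ e ∈ φ.edges, G.w e.1 e.2

end RootedForest

end Basic

section Estimator

variable {V : Type*} [Fintype V] [DecidableEq V] (G : WeightedGraph V)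

/-- The law of the random spanning forest `Φ_Q` with parameters `q`:
`P(Φ_Q = φ) = weight q φ / ∑_ψ weight q ψ`. -/
noncomputable def rsfLaw (q : V → ℝ) : Measure G.RootedForest :=
  ∑ φ : G.RootedForest,
    ENNReal.ofReal (φ.weight q / ∑ ψ : G.RootedForest, ψ.weight q) • Measure.dirac φ

variable {G} in
/-- The forest estimator `x̃`, as a function of the forest: `x̃(i) = y(r_φ(i))`. -/
noncomputable def rsfEstimator (y : V → ℝ) (φ : G.RootedForest) : V → ℝ :=
  fun i => y (φ.root i)

/-- The parameters `q_i = α` on the labelled vertices `ℓ` and `q_i = 0` on the others. -/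
def labelledParam (ℓ : Finset V) (α : ℝ) : V → ℝ :=
  fun i => if i ∈ ℓ then α else 0

/-- The block `L_{u|u}`, where `u` is the complement of `ℓ`. -/
def laplacianUU (ℓ : Finset V) : Matrix {i // i ∉ ℓ} {i // i ∉ ℓ} ℝ :=
  G.laplacian.submatrix Subtype.val Subtype.val

/-- The block `L_{u|ℓ}`, where `u` is the complement of `ℓ`. -/
def laplacianUL (ℓ : Finset V) : Matrix {i // i ∉ ℓ} {i // i ∈ ℓ} ℝ :=
  G.laplacian.submatrix Subtype.val Subtype.val

/-- `f` solves the Dirichlet problem of label propagation with labels `y` on `ℓ`: it is harmonic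
at the unlabelled vertices and equals `y` on `ℓ`. -/
def IsDirichletSolution (ℓ : Finset V) (y f : V → ℝ) : Prop :=
  (∀ i, i ∉ ℓ → (G.laplacian.mulVec f) i = 0) ∧ ∀ i ∈ ℓ, f i = y i

/-- The label propagation solution: `y` on `ℓ` and `-(L_{u|u})⁻¹ L_{u|ℓ} y_ℓ` on `u`. -/
noncomputable def labelPropagation (ℓ : Finset V) (y : V → ℝ) : V → ℝ :=
  fun i => if h : i ∈ ℓ then y i else
    (-((G.laplacianUU ℓ)⁻¹ * G.laplacianUL ℓ)).mulVec (fun j => y j.1) ⟨i, h⟩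

end Estimator

end WeightedGraph

/-! For each finite α > 0 the function `E[x̃]` is already exactly harmonic on the unlabelled
vertices; only its values on `ℓ` depart from `y`. Harmonicity at i with `q i = 0` comes from an edge
exchange: on pairs (forest, extra edge i → j), swapping the extra edge with the one leaving i
preserves the total weight and flips the sign of `y (root i) - y (root j)`
(`sum_weight_mul_sub_root_eq_zero`).

A labelled vertex i fails to be a root with probability at most `(∑ j, w i j) / α`, because cutting
its outgoing edge trades a factor `w i j` for α (`mul_sum_weight_le`). Hence the boundary values
converge to `y`.

The maximum principle makes `L_{u|u}` invertible, so `E[x̃]` is the label propagation of its own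
boundary values (`isDirichletSolution_iff`). Label propagation is continuous in those values, which
gives the limit. -/

namespace WeightedGraph

section Forests

variable {V : Type*} {G : WeightedGraph V}

/-- Each vertex outside `ℓ` points to a neighbour strictly closer to `ℓ`. This forest makes the
normalizing constant positive, and its paths carry maxima to `ℓ` in the maximum principle. -/
theorem exists_forest_roots_eq (ℓ : Finset V)
    (hℓ : ∀ i, ∃ j ∈ ℓ, G.toSimpleGraph.Reachable i j) :
    ∃ φ : G.RootedForest, ∀ i, φ.next i = none ↔ i ∈ ℓ := by
  classical
  have hex : ∀ i, ∃ n, ∃ j ∈ ℓ, ∃ p : G.toSimpleGraph.Walk i j, p.length = n := fun i => by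
    obtain ⟨j, hj, ⟨p⟩⟩ := hℓ i
    exact ⟨_, j, hj, p, rfl⟩
  let d : V → ℕ := fun i => Nat.find (hex i)
  have hstep : ∀ i, i ∉ ℓ → ∃ k, 0 < G.w i k ∧ d k < d i := by
    intro i hi
    obtain ⟨j, hj, p, hp⟩ := Nat.find_spec (hex i)
    cases p with
    | nil => exact absurd hj hi
    | @cons _ k _ h p =>
      refine ⟨k, h.2, ?_⟩
      have : d k ≤ p.length := Nat.find_min' (hex k) ⟨j, hj, p, rfl⟩
      have hd : d i = p.length + 1 := hp.symm
      omega
  choose! s hs hsd using hstep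
  refine ⟨⟨fun i => if i ∈ ℓ then none else some (s i), ?_, ?_⟩, ?_⟩
  · intro i j h
    by_cases hi : i ∈ ℓ
    · simp [hi] at h
    · simp only [hi, if_false, Option.some.injEq] at h
      exact h ▸ hs i hi
  · intro i
    induction hn : d i using Nat.strong_induction_on generalizing i with
    | _ n ih =>
      by_cases hi : i ∈ ℓ
      · exact ⟨i, by simp [hi], .refl⟩
      · obtain ⟨r, hr, hp⟩ := ih (d (s i)) (hn ▸ hsd i hi) (s i) rfl
        exact ⟨r, hr, .head (by simp [hi]) hp⟩
  · intro i
    simp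

/-! ### Paths, roots and surgery on forests -/

namespace RootedForest

theorem root_of_next_none (φ : G.RootedForest) {i : V} (h : φ.next i = none) : φ.root i = i :=
  φ.root_eq h .refl

theorem root_eq_of_path (φ : G.RootedForest) {i j : V}
    (h : Relation.ReflTransGen (fun a b => φ.next a = some b) i j) : φ.root i = φ.root j :=
  φ.root_eq (φ.next_root j) (h.trans (φ.path_root j))

/-- On a cycle through i, every vertex reachable from i could return to i; the root of i is
reachable but has no way out. -/
theorem not_path_of_next (φ : G.RootedForest) {i k : V} (h : φ.next i = some k) :
    ¬ Relation.ReflTransGen (fun a b => φ.next a = some b) k i := by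
  intro hki
  have key : ∀ a, Relation.ReflTransGen (fun a b => φ.next a = some b) i a →
      Relation.ReflTransGen (fun a b => φ.next a = some b) a i := by
    intro a ha
    induction ha with
    | refl => exact .refl
    | @tail b c _ hbc ih =>
      rcases Relation.ReflTransGen.cases_head ih with hb | ⟨d, hd, hdi⟩
      · subst hb
        rwa [Option.some.inj (hbc.symm.trans h)]
      · rwa [Option.some.inj (hbc.symm.trans hd)]
  rcases Relation.ReflTransGen.cases_head (key _ (φ.path_root i)) with hr | ⟨d, hd, _⟩
  · rw [← hr, φ.next_root] at h
    simp at h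
  · rw [φ.next_root] at hd
    simp at hd

variable [DecidableEq V]

theorem path_update (φ : G.RootedForest) {i j r : V} (o : Option V)
    (hr : Relation.ReflTransGen (fun a b => φ.next a = some b) j r)
    (hi : ¬ Relation.ReflTransGen (fun a b => φ.next a = some b) j i) :
    Relation.ReflTransGen (fun a b => Function.update φ.next i o a = some b) j r := by
  induction hr using Relation.ReflTransGen.head_induction_on with
  | refl => exact .refl
  | @head a c hac _ ih =>
    have hai : a ≠ i := fun h => hi (h ▸ .refl)
    refine .head ?_ (ih fun h => hi (.head hac h))
    rwa [Function.update_of_ne hai]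

/-- Replace the edge leaving `i` by `o`, an edge to a vertex that is not a descendant of `i`
(or no edge at all, making `i` a root). -/
def redirect (φ : G.RootedForest) (i : V) (o : Option V)
    (ho : ∀ j, o = some j →
      0 < G.w i j ∧ ¬ Relation.ReflTransGen (fun a b => φ.next a = some b) j i) :
    G.RootedForest where
  next := Function.update φ.next i o
  edge_pos a b h := by
    by_cases hai : a = i
    · subst hai
      rw [Function.update_self] at h
      exact (ho b h).1
    · rw [Function.update_of_ne hai] at h
      exact φ.edge_pos a b h
  exists_root a := by
    have hi : ∃ r, Function.update φ.next i o r = none ∧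
        Relation.ReflTransGen (fun a b => Function.update φ.next i o a = some b) i r := by
      cases o with
      | none => exact ⟨i, by simp, .refl⟩
      | some j =>
        have hj := (ho j rfl).2
        have hne : φ.root j ≠ i := fun h => hj (h ▸ φ.path_root j)
        refine ⟨φ.root j, ?_, .head (by simp) (φ.path_update _ (φ.path_root j) hj)⟩
        rw [Function.update_of_ne hne, φ.next_root]
    obtain ⟨r, hr, ha⟩ := φ.exists_root a
    induction ha using Relation.ReflTransGen.head_induction_on with
    | refl =>
      by_cases h : r = i
      · rwa [h]
      · exact ⟨r, by rwa [Function.update_of_ne h], .refl⟩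
    | @head b c hbc _ ih =>
      by_cases h : b = i
      · rwa [h]
      · obtain ⟨r, hr, hp⟩ := ih
        exact ⟨r, hr, .head (by rwa [Function.update_of_ne h]) hp⟩

theorem root_redirect_of_not_path (φ : G.RootedForest) {i j : V} (o : Option V) (ho)
    (hj : ¬ Relation.ReflTransGen (fun a b => φ.next a = some b) j i) :
    (φ.redirect i o ho).root j = φ.root j := by
  have hne : φ.root j ≠ i := fun h => hj (h ▸ φ.path_root j)
  refine root_eq _ ?_ (φ.path_update o (φ.path_root j) hj)
  change Function.update φ.next i o (φ.root j) = none
  rw [Function.update_of_ne hne, φ.next_root]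

theorem root_redirect_self (φ : G.RootedForest) {i j : V} (ho) :
    (φ.redirect i (some j) ho).root i = φ.root j := by
  rw [← φ.root_redirect_of_not_path (some j) ho (ho j rfl).2]
  exact root_eq_of_path _ (.single (by simp [redirect]))

/-- A path that has not yet met i uses only unchanged edges. This lets the edge exchange be undone.
-/
theorem not_path_redirect (φ : G.RootedForest) {i k : V} (o : Option V) (ho)
    (hk : ¬ Relation.ReflTransGen (fun a b => φ.next a = some b) k i) :
    ¬ Relation.ReflTransGen (fun a b => (φ.redirect i o ho).next a = some b) k i := by
  have key : ∀ c, Relation.ReflTransGen (fun a b => (φ.redirect i o ho).next a = some b) k c →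
      Relation.ReflTransGen (fun a b => φ.next a = some b) k c := by
    intro c hc
    induction hc with
    | refl => exact .refl
    | @tail b c _ hbc ih =>
      have hb : b ≠ i := fun h => hk (h ▸ ih)
      refine ih.tail ?_
      simpa [redirect, Function.update_of_ne hb] using hbc
  exact fun h => hk (key i h)

/-! ### Weights of forests -/

variable [Fintype V]

/-- A vertex is either a root or has exactly one outgoing edge, so it contributes exactly one
factor. -/
theorem weight_eq_prod (q : V → ℝ) (φ : G.RootedForest) :
    φ.weight q = ∏ i, (φ.next i).elim (q i) (G.w i) := by
  have h1 : ∏ i ∈ φ.roots, q i = ∏ i, if φ.next i = none then q i else 1 := by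
    rw [roots, Finset.prod_filter]
  have h2 : ∏ e ∈ φ.edges, G.w e.1 e.2 =
      ∏ i, ∏ j, if φ.next i = some j then G.w i j else 1 := by
    rw [edges, Finset.prod_filter, Fintype.prod_prod_type]
  rw [weight, h1, h2, ← Finset.prod_mul_distrib]
  refine Finset.prod_congr rfl fun i _ => ?_
  cases h : φ.next i <;> simp

theorem weight_nonneg {q : V → ℝ} (hq : ∀ i, 0 ≤ q i) (φ : G.RootedForest) :
    0 ≤ φ.weight q := by
  rw [weight_eq_prod]
  refine Finset.prod_nonneg fun i _ => ?_
  cases φ.next i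
  · exact hq i
  · exact G.nonneg _ _

/-- Only the factor at i changes. The cross-multiplied form remains valid when that factor is zero.
-/
theorem weight_redirect (q : V → ℝ) (φ : G.RootedForest) (i : V) (o : Option V) (ho) :
    (φ.next i).elim (q i) (G.w i) * (φ.redirect i o ho).weight q =
      o.elim (q i) (G.w i) * φ.weight q := by
  have h : ∏ k ∈ Finset.univ.erase i, ((φ.redirect i o ho).next k).elim (q k) (G.w k) =
      ∏ k ∈ Finset.univ.erase i, (φ.next k).elim (q k) (G.w k) := by
    refine Finset.prod_congr rfl fun k hk => ?_
    simp [redirect, Function.update_of_ne (Finset.ne_of_mem_erase hk)]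
  rw [weight_eq_prod, weight_eq_prod, ← Finset.mul_prod_erase _ _ (Finset.mem_univ i),
    ← Finset.mul_prod_erase _ (fun k => (φ.next k).elim (q k) (G.w k)) (Finset.mem_univ i), h]
  simp only [redirect, Function.update_self]
  ring

end RootedForest

/-! ### Edge exchange and edge cutting -/

variable [Fintype V] [DecidableEq V]

/-- Exchanging the edge leaving `i` with an extra edge `i → j` is an involution on the pairs
(forest, extra edge), which makes the forest sums harmonic at every vertex `i` with `q i = 0`. -/
theorem sum_weight_mul_sub_root_eq_zero {q : V → ℝ} {i : V} (hq : q i = 0) (y : V → ℝ) :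
    ∑ p : G.RootedForest × V,
      G.w i p.2 * (p.1.weight q * (y (p.1.root i) - y (p.1.root p.2))) = 0 := by
  classical
  -- The pairs that can be exchanged. Every other term vanishes: there is no edge, or j descends
  -- from i and shares its root, or i is a root and contributes the factor `q i = 0`.
  let good : G.RootedForest × V → Prop := fun p =>
    0 < G.w i p.2 ∧ ¬ Relation.ReflTransGen (fun a b => p.1.next a = some b) p.2 i ∧
      (p.1.next i).isSome
  have hbad : ∀ p, ¬ good p →
      G.w i p.2 * (p.1.weight q * (y (p.1.root i) - y (p.1.root p.2))) = 0 := by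
    rintro ⟨φ, j⟩ hp
    rcases (G.nonneg i j).eq_or_lt with h1 | h1
    · simp [← h1]
    by_cases h2 : Relation.ReflTransGen (fun a b => φ.next a = some b) j i
    · simp [φ.root_eq_of_path h2]
    have h3 : φ.next i = none := by
      by_contra h3
      exact hp ⟨h1, h2, Option.isSome_iff_ne_none.2 h3⟩
    have : φ.weight q = 0 := by
      rw [RootedForest.weight_eq_prod]
      exact Finset.prod_eq_zero (Finset.mem_univ i) (by simp [h3, hq])
    simp [this]
  rw [← Finset.sum_filter_add_sum_filter_not _ good,
    Finset.sum_eq_zero (s := Finset.univ.filter fun p => ¬ good p)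
      (fun p hp => hbad p (Finset.mem_filter.1 hp).2), add_zero]
  have hgood : ∀ {p}, p ∈ Finset.univ.filter good → good p := fun hp => (Finset.mem_filter.1 hp).2
  let swap : (p : G.RootedForest × V) → p ∈ Finset.univ.filter good → G.RootedForest × V :=
    fun p hp => (p.1.redirect i (some p.2) (fun j hj => by
      obtain rfl := Option.some.inj hj
      exact ⟨(hgood hp).1, (hgood hp).2.1⟩), (p.1.next i).get (hgood hp).2.2)
  have hcancel : ∀ p hp,
      G.w i p.2 * (p.1.weight q * (y (p.1.root i) - y (p.1.root p.2))) +
      G.w i (swap p hp).2 * ((swap p hp).1.weight q *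
        (y ((swap p hp).1.root i) - y ((swap p hp).1.root (swap p hp).2))) = 0 := by
    rintro ⟨φ, j⟩ hp
    obtain ⟨k, hk⟩ := Option.isSome_iff_exists.1 (hgood hp).2.2
    have hk' : φ.next i = some k := hk
    have hnk := φ.not_path_of_next hk'
    simp only [swap, hk', Option.get_some]
    have hw := φ.weight_redirect q i (some j) (fun j' hj => by
      obtain rfl := Option.some.inj hj
      exact ⟨(hgood hp).1, (hgood hp).2.1⟩)
    -- After the swap, i has the old root of j, while k keeps its root, the old root of i: the
    -- difference changes sign and the weights agree by `hw`.
    rw [show (φ.next i).elim (q i) (G.w i) = G.w i k by rw [hk', Option.elim_some],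
      Option.elim_some] at hw
    rw [← mul_assoc (G.w i k), hw, φ.root_redirect_self, φ.root_redirect_of_not_path _ _ hnk,
      ← φ.root_eq_of_path (.single hk')]
    ring
  refine Finset.sum_involution swap hcancel ?_ ?_ ?_
  · intro p hp h hfix
    -- A fixed point's term equals its own negative, so it is zero.
    have := hcancel p hp
    rw [hfix] at this
    exact h (by linarith)
  · rintro ⟨φ, j⟩ hp
    obtain ⟨k, hk⟩ := Option.isSome_iff_exists.1 (hgood hp).2.2
    have hk' : φ.next i = some k := hk
    refine Finset.mem_filter.2 ⟨Finset.mem_univ _, ?_, ?_, ?_⟩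
    · simpa [swap, hk'] using φ.edge_pos i k hk'
    · simp only [swap, hk', Option.get_some]
      exact φ.not_path_redirect _ _ (φ.not_path_of_next hk')
    · simp [swap, RootedForest.redirect]
  · rintro ⟨φ, j⟩ hp
    refine Prod.ext (RootedForest.ext ?_) ?_
    · simp [swap, RootedForest.redirect]
    · simp [swap, RootedForest.redirect]

theorem laplacian_mulVec_apply (f : V → ℝ) (i : V) :
    (G.laplacian.mulVec f) i = ∑ j, G.w i j * (f i - f j) := by
  simp only [laplacian, Matrix.sub_mulVec, Pi.sub_apply, Matrix.mulVec_diagonal, Finset.sum_mul,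
    mul_sub, Finset.sum_sub_distrib]
  rfl

/-- Making the vertex `i` a root bounds the weight of the forests that contain the edge `(i, j)`. -/
theorem mul_sum_weight_le {q : V → ℝ} (hq : ∀ i, 0 ≤ q i) (i j : V) :
    q i * ∑ φ : G.RootedForest with φ.next i = some j, φ.weight q ≤
      G.w i j * ∑ φ : G.RootedForest, φ.weight q := by
  classical
  have ho : ∀ (φ : G.RootedForest) k, (none : Option V) = some k →
      0 < G.w i k ∧ ¬ Relation.ReflTransGen (fun a b => φ.next a = some b) k i := by
    intro _ _ h
    simp at h
  let cut : G.RootedForest → G.RootedForest := fun φ => φ.redirect i none (ho φ)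
  -- The deleted edge is known to be i → j, so it can be restored.
  have hinj : Set.InjOn cut (Finset.univ.filter fun φ : G.RootedForest => φ.next i = some j) := by
    intro φ hφ ψ hψ h
    have hφ' : φ.next i = some j := by simpa using hφ
    have hψ' : ψ.next i = some j := by simpa using hψ
    ext1
    funext k
    by_cases hk : k = i
    · rw [hk, hφ', hψ']
    · have := congrFun (congrArg RootedForest.next h) k
      simpa [cut, RootedForest.redirect, Function.update_of_ne hk] using this
  calc q i * ∑ φ : G.RootedForest with φ.next i = some j, φ.weight q
      = G.w i j * ∑ φ : G.RootedForest with φ.next i = some j, (cut φ).weight q := by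
        rw [Finset.mul_sum, Finset.mul_sum]
        refine Finset.sum_congr rfl fun φ hφ => ?_
        have hw := φ.weight_redirect q i none (ho φ)
        rw [(Finset.mem_filter.1 hφ).2] at hw
        exact hw.symm
    _ = G.w i j * ∑ φ ∈ (Finset.univ.filter fun φ : G.RootedForest => φ.next i = some j).image cut,
          φ.weight q := by rw [Finset.sum_image hinj]
    _ ≤ _ := mul_le_mul_of_nonneg_left
        (Finset.sum_le_sum_of_subset_of_nonneg (Finset.subset_univ _)
          fun φ _ _ => φ.weight_nonneg hq) (G.nonneg i j)

/-! ### The Dirichlet problem -/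

/-- The maximum principle. -/
theorem nonpos_of_harmonic {ℓ : Finset V} (hℓ : ∀ i, ∃ j ∈ ℓ, G.toSimpleGraph.Reachable i j)
    {f : V → ℝ} (hf : ∀ i, i ∉ ℓ → (G.laplacian.mulVec f) i = 0) (h0 : ∀ i ∈ ℓ, f i ≤ 0) (i : V) :
    f i ≤ 0 := by
  obtain ⟨φ, hφ⟩ := exists_forest_roots_eq ℓ hℓ
  obtain ⟨m, -, hm⟩ := Finset.exists_max_image Finset.univ f ⟨i, Finset.mem_univ i⟩
  have key : ∀ a, Relation.ReflTransGen (fun a b => φ.next a = some b) m a → f a = f m := by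
    intro a ha
    induction ha with
    | refl => rfl
    | @tail b c _ hbc ih =>
      have hb : b ∉ ℓ := fun h => by
        rw [(hφ b).2 h] at hbc
        simp at hbc
      have hsum := hf b hb
      -- At a maximum all terms `w b j * (f b - f j)` are nonnegative, so a zero sum forces equality
      -- along every edge, in particular b → c.
      rw [laplacian_mulVec_apply, Finset.sum_eq_zero_iff_of_nonneg fun j _ =>
        mul_nonneg (G.nonneg b j) (by linarith [hm j (Finset.mem_univ j)])] at hsum
      have := hsum c (Finset.mem_univ c)
      rcases mul_eq_zero.1 this with h | h
      · exact absurd h (φ.edge_pos b c hbc).ne'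
      · linarith
  calc f i ≤ f m := hm i (Finset.mem_univ i)
    _ = f (φ.root m) := (key _ (φ.path_root m)).symm
    _ ≤ 0 := h0 _ ((hφ _).1 (φ.next_root m))

theorem laplacian_mulVec_eq_blocks (ℓ : Finset V) (f : V → ℝ) (i : {i // i ∉ ℓ}) :
    (G.laplacian.mulVec f) i =
      ((G.laplacianUU ℓ).mulVec (fun j => f j) + (G.laplacianUL ℓ).mulVec (fun j => f j)) i := by
  simp only [Matrix.mulVec, dotProduct, Pi.add_apply, laplacianUU, laplacianUL,
    Matrix.submatrix_apply]
  rw [add_comm]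
  convert (Fintype.sum_subtype_add_sum_subtype (· ∈ ℓ) fun j => G.laplacian i j * f j).symm

/-- A kernel vector, extended by zero on `ℓ`, is harmonic off `ℓ`; the maximum principle for it and
its negative makes it vanish. -/
theorem isUnit_det_laplacianUU {ℓ : Finset V}
    (hℓ : ∀ i, ∃ j ∈ ℓ, G.toSimpleGraph.Reachable i j) : IsUnit (G.laplacianUU ℓ).det := by
  rw [isUnit_iff_ne_zero]
  intro hdet
  obtain ⟨v, hv, hv0⟩ := Matrix.exists_mulVec_eq_zero_iff.2 hdet
  let f : V → ℝ := fun i => if h : i ∈ ℓ then 0 else v ⟨i, h⟩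
  have hfu : (fun j : {i // i ∉ ℓ} => f j) = v := by
    funext j
    simp [f, j.2]
  have hfl : (fun j : {i // i ∈ ℓ} => f j) = 0 := by
    funext j
    simp [f]
  have hf : ∀ i, i ∉ ℓ → (G.laplacian.mulVec f) i = 0 := fun i hi => by
    rw [laplacian_mulVec_eq_blocks ℓ f ⟨i, hi⟩, hfu, hfl, hv0]
    simp
  have h1 := nonpos_of_harmonic hℓ hf (fun i hi => by simp [f, hi])
  have h2 := nonpos_of_harmonic hℓ (f := -f) (fun i hi => by simp [Matrix.mulVec_neg, hf i hi])
    (fun i hi => by simp [f, hi])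
  refine hv (hfu ▸ funext fun j => le_antisymm (h1 j) ?_)
  simpa using h2 j

theorem isDirichletSolution_iff {ℓ : Finset V} (hdet : IsUnit (G.laplacianUU ℓ).det)
    (y f : V → ℝ) : G.IsDirichletSolution ℓ y f ↔ f = G.labelPropagation ℓ y := by
  have hblock : ∀ f : V → ℝ, (∀ i ∈ ℓ, f i = y i) → ∀ i : {i // i ∉ ℓ},
      (G.laplacian.mulVec f) i = ((G.laplacianUU ℓ).mulVec (fun j => f j) +
        (G.laplacianUL ℓ).mulVec (fun j => y j)) i := fun f hf i => by
    rw [laplacian_mulVec_eq_blocks,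
      show (fun j : {i // i ∈ ℓ} => f j.1) = fun j => y j.1 from
        funext fun j => hf j j.2]
  constructor
  · rintro ⟨hharm, hy⟩
    have h0 : (G.laplacianUU ℓ).mulVec (fun j => f j) =
        -(G.laplacianUL ℓ).mulVec (fun j => y j) :=
      eq_neg_of_add_eq_zero_left (funext fun i => (hblock f hy i).symm.trans (hharm i i.2))
    have h1 := congrArg (G.laplacianUU ℓ)⁻¹.mulVec h0
    rw [Matrix.mulVec_mulVec, Matrix.nonsing_inv_mul _ hdet, Matrix.one_mulVec, Matrix.mulVec_neg,
      Matrix.mulVec_mulVec, ← Matrix.neg_mulVec] at h1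
    funext i
    by_cases hi : i ∈ ℓ
    · simp [labelPropagation, hi, hy i hi]
    · simpa [labelPropagation, hi] using congrFun h1 ⟨i, hi⟩
  · rintro rfl
    have hy : ∀ i ∈ ℓ, G.labelPropagation ℓ y i = y i := fun i hi => by
      simp [labelPropagation, hi]
    refine ⟨fun i hi => ?_, hy⟩
    have hu : (fun j : {i // i ∉ ℓ} => G.labelPropagation ℓ y j) =
        (-((G.laplacianUU ℓ)⁻¹ * G.laplacianUL ℓ)).mulVec (fun j => y j.1) := by
      funext j
      simp [labelPropagation, j.2]
    rw [hblock _ hy ⟨i, hi⟩, hu, Matrix.mulVec_mulVec, Matrix.mul_neg,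
      Matrix.mul_nonsing_inv_cancel_left _ _ hdet, Matrix.neg_mulVec, neg_add_cancel]
    rfl

theorem tendsto_labelPropagation {ι : Type*} {l : Filter ι} {ℓ : Finset V} {F : ι → V → ℝ}
    {y : V → ℝ} (h : ∀ i ∈ ℓ, Tendsto (fun a => F a i) l (𝓝 (y i))) :
    Tendsto (fun a => G.labelPropagation ℓ (F a)) l (𝓝 (G.labelPropagation ℓ y)) := by
  rw [tendsto_pi_nhds]
  intro i
  by_cases hi : i ∈ ℓ
  · simpa [labelPropagation, hi] using h i hi
  · simp only [labelPropagation, hi, dif_neg, not_false_eq_true]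
    exact tendsto_finsetSum _ fun j _ => (h j j.2).const_mul _

/-! ### The forest law and the expectation of the estimator -/

theorem sum_weight_pos {ℓ : Finset V} (hℓ : ∀ i, ∃ j ∈ ℓ, G.toSimpleGraph.Reachable i j)
    {α : ℝ} (hα : 0 < α) : 0 < ∑ φ : G.RootedForest, φ.weight (labelledParam ℓ α) := by
  have hq : ∀ i, 0 ≤ labelledParam ℓ α i := fun i => by
    unfold labelledParam
    split_ifs <;> linarith
  obtain ⟨φ, hφ⟩ := exists_forest_roots_eq ℓ hℓ
  refine Finset.sum_pos' (fun ψ _ => ψ.weight_nonneg hq) ⟨φ, Finset.mem_univ _, ?_⟩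
  rw [RootedForest.weight_eq_prod]
  refine Finset.prod_pos fun i _ => ?_
  cases h : φ.next i with
  | none => simpa [labelledParam, (hφ i).1 h] using hα
  | some j => exact φ.edge_pos i j h

theorem isProbabilityMeasure_rsfLaw {q : V → ℝ} (hq : ∀ i, 0 ≤ q i)
    (hZ : 0 < ∑ φ : G.RootedForest, φ.weight q) : IsProbabilityMeasure (G.rsfLaw q) := by
  constructor
  simp only [rsfLaw, Measure.finsetSum_apply, Measure.smul_apply, measure_univ, smul_eq_mul,
    mul_one]
  rw [← ENNReal.ofReal_sum_of_nonneg fun φ _ => div_nonneg (φ.weight_nonneg hq) hZ.le,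
    ← Finset.sum_div, div_self hZ.ne', ENNReal.ofReal_one]

/-- The normalizing constant may be zero here: division by zero then makes both sides zero. -/
theorem integral_rsfEstimator {q : V → ℝ} (hq : ∀ i, 0 ≤ q i) (y : V → ℝ) (i : V) :
    (∫ φ, rsfEstimator y φ ∂(G.rsfLaw q)) i =
      (∑ φ : G.RootedForest, φ.weight q * y (φ.root i)) / ∑ φ : G.RootedForest, φ.weight q := by
  have : MeasurableSingletonClass G.RootedForest := ⟨fun _ => trivial⟩
  have hc : ∀ φ : G.RootedForest, 0 ≤ φ.weight q / ∑ ψ : G.RootedForest, ψ.weight q := fun φ =>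
    div_nonneg (φ.weight_nonneg hq) (Finset.sum_nonneg fun ψ _ => ψ.weight_nonneg hq)
  rw [rsfLaw, integral_finsetSum_measure fun φ _ =>
    (integrable_dirac (by simp)).smul_measure ENNReal.ofReal_ne_top]
  simp only [integral_smul_measure, integral_dirac, ENNReal.toReal_ofReal (hc _),
    Finset.sum_apply, Pi.smul_apply, smul_eq_mul, rsfEstimator, Finset.sum_div]
  exact Finset.sum_congr rfl fun φ _ => by ring

theorem laplacian_mulVec_integral_rsfEstimator {q : V → ℝ} (hq : ∀ i, 0 ≤ q i) (y : V → ℝ)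
    {i : V} (hi : q i = 0) :
    (G.laplacian.mulVec (∫ φ, rsfEstimator y φ ∂(G.rsfLaw q))) i = 0 := by
  have h := sum_weight_mul_sub_root_eq_zero (G := G) hi y
  rw [Fintype.sum_prod_type_right] at h
  simp only [laplacian_mulVec_apply, integral_rsfEstimator hq, ← sub_div, ← Finset.sum_sub_distrib,
    ← mul_sub, ← mul_div_assoc, ← Finset.sum_div, Finset.mul_sum]
  rw [h, zero_div]

/-- Only forests in which i is not a root contribute, each with an error of at most C times its
weight. Grouping them by the edge leaving i reduces the bound to `mul_sum_weight_le`. -/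
theorem abs_integral_rsfEstimator_sub_le {q : V → ℝ} (hq : ∀ i, 0 ≤ q i)
    (hZ : 0 < ∑ φ : G.RootedForest, φ.weight q) {y : V → ℝ} {C : ℝ} (hC : ∀ i j, |y i - y j| ≤ C)
    {i : V} (hi : 0 < q i) :
    |(∫ φ, rsfEstimator y φ ∂(G.rsfLaw q)) i - y i| ≤ (C * ∑ j, G.w i j) / q i := by
  have hC0 : 0 ≤ C := (abs_nonneg _).trans (hC i i)
  rw [integral_rsfEstimator hq, div_sub' hZ.ne', abs_div, abs_of_pos hZ, div_le_div_iff₀ hZ hi]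
  have h1 : |∑ φ : G.RootedForest, φ.weight q * y (φ.root i) -
      (∑ φ : G.RootedForest, φ.weight q) * y i| ≤
      C * ∑ j, ∑ φ : G.RootedForest with φ.next i = some j, φ.weight q := by
    rw [Finset.sum_mul, ← Finset.sum_sub_distrib]
    refine (Finset.abs_sum_le_sum_abs _ _).trans ?_
    simp only [Finset.sum_filter]
    rw [Finset.sum_comm, Finset.mul_sum]
    refine Finset.sum_le_sum fun φ _ => ?_
    have hw := φ.weight_nonneg hq
    rw [← mul_sub, abs_mul, abs_of_nonneg hw]
    cases h : φ.next i with
    | none => simp [φ.root_of_next_none h]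
    | some j =>
      simp only [Option.some.injEq, Finset.sum_ite_eq, Finset.mem_univ, if_true]
      rw [mul_comm C]
      exact mul_le_mul_of_nonneg_left (hC _ _) hw
  calc _ ≤ (C * ∑ j, ∑ φ : G.RootedForest with φ.next i = some j, φ.weight q) * q i :=
        mul_le_mul_of_nonneg_right h1 hi.le
    _ = C * ∑ j, q i * ∑ φ : G.RootedForest with φ.next i = some j, φ.weight q := by
        rw [← Finset.mul_sum]
        ring
    _ ≤ C * ∑ j, G.w i j * ∑ φ : G.RootedForest, φ.weight q :=
        mul_le_mul_of_nonneg_left (Finset.sum_le_sum fun j _ => mul_sum_weight_le hq i j) hC0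
    _ = _ := by
        rw [← Finset.sum_mul]
        ring

end Forests

end WeightedGraph

theorem proposition3 {V : Type*} [Fintype V] [DecidableEq V] (G : WeightedGraph V)
    (ℓ : Finset V) (hℓ : ∀ i, ∃ j ∈ ℓ, G.toSimpleGraph.Reachable i j) (y : V → ℝ) :
    -- the objects in the claim are well defined
    IsUnit (G.laplacianUU ℓ).det ∧
    (∀ α : ℝ, 0 < α → IsProbabilityMeasure (G.rsfLaw (WeightedGraph.labelledParam ℓ α))) ∧
    -- the closed formula is the unique solution of the Dirichlet problem
    (∀ f : V → ℝ, G.IsDirichletSolution ℓ y f ↔ f = G.labelPropagation ℓ y) ∧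
    -- the expectation of the estimator converges to it
    Tendsto
      (fun α : ℝ => ∫ φ, WeightedGraph.rsfEstimator y φ ∂(G.rsfLaw (WeightedGraph.labelledParam ℓ α)))
      atTop (𝓝 (G.labelPropagation ℓ y)) := by
  classical
  have hdet := WeightedGraph.isUnit_det_laplacianUU hℓ
  have hq : ∀ α : ℝ, 0 < α → ∀ i, 0 ≤ WeightedGraph.labelledParam ℓ α i := fun α hα i => by
    unfold WeightedGraph.labelledParam
    split_ifs <;> linarith
  have hiff := WeightedGraph.isDirichletSolution_iff hdet
  refine ⟨hdet, fun α hα => WeightedGraph.isProbabilityMeasure_rsfLaw (hq α hα)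
    (WeightedGraph.sum_weight_pos hℓ hα), hiff y, ?_⟩
  have hboundary : ∀ i ∈ ℓ, Tendsto (fun α : ℝ =>
      (∫ φ, WeightedGraph.rsfEstimator y φ ∂(G.rsfLaw (WeightedGraph.labelledParam ℓ α))) i)
      atTop (𝓝 (y i)) := by
    intro i hi
    obtain ⟨C, hC⟩ : ∃ C, ∀ p : V × V, |y p.1 - y p.2| ≤ C :=
      (Set.finite_range fun p : V × V => |y p.1 - y p.2|).bddAbove.imp
        fun C hC p => hC ⟨p, rfl⟩
    rw [tendsto_iff_norm_sub_tendsto_zero]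
    refine squeeze_zero' (.of_forall fun _ => norm_nonneg _) ?_
      ((tendsto_const_nhds (x := C * ∑ j, G.w i j)).div_atTop tendsto_id)
    filter_upwards [eventually_gt_atTop 0] with α hα
    have hqi : WeightedGraph.labelledParam ℓ α i = α := by simp [WeightedGraph.labelledParam, hi]
    have := WeightedGraph.abs_integral_rsfEstimator_sub_le (hq α hα)
      (WeightedGraph.sum_weight_pos hℓ hα) (fun i j => hC (i, j)) (hα.trans_eq hqi.symm)
    rwa [hqi] at this
  -- For α > 0 the expectation solves the Dirichlet problem with itself as boundary data, so it
  -- equals its own label propagation.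
  refine (WeightedGraph.tendsto_labelPropagation hboundary).congr' ?_
  filter_upwards [eventually_gt_atTop 0] with α hα
  exact ((hiff _ _).1 ⟨fun i hi => WeightedGraph.laplacian_mulVec_integral_rsfEstimator (hq α hα) y
    (by simp [WeightedGraph.labelledParam, hi]), fun _ _ => rfl⟩).symm
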